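/- Let $K=\{0\}\cup[1,2]\subset\mathbb R$ and let $\mathcal P(K)$ be the set of Borel probability measures on $K$, endowed with the weak topology. A property is said to hold for a typical $\mu\in\mathcal P(K)$ if it is satisfied by all the elements of some dense $G_\delta$ subset of $\mathcal P(K)$. For $\mu\in\mathcal P(K)$ let $$\overline D_\mu(1)=\limsup_{r\to 0^+}\frac{\int_K\log\mu\big(B(x,r)\big)\,d\mu(x)}{\log r}\in[-\infty,+\infty]$$ be the upper $L^1$-dimension of $\mu$, where $B(x,r)$ is the open ball with center $x$ and radius $r$. Then: 1. a typical $\mu\in\mathcal P(K)$ satisfies $\overline D_\mu(1)\in[0,1]$; 2. this interval is the best possible: if $a,b\in[-\infty,+\infty]$ are such that a typical $\mu\in\mathcal P(K)$ satisfies $\overline D_\mu(1)\in[a,b]$, then $a\le 0$ and $b\ge 1$; 3. consequently there is no typical value of the upper $L^1$-dimension: there is no $s\in[-\infty,+\infty]$ such that a typical $\mu\in\mathcal P(K)$ satisfies $\overline D_\mu(1)=s$. -/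

import Mathlib

open MeasureTheory Filter Topology Set

/-- A property holds for a typical element of `X` if it is satisfied by all the elements of some
dense `Gδ` subset of `X`. -/
def Typical {X : Type*} [TopologicalSpace X] (p : X → Prop) : Prop :=
  ∃ S : Set X, IsGδ S ∧ Dense S ∧ ∀ x ∈ S, p x

/-- `I_μ(r, 1) = ∫ log μ(B(x, r)) dμ(x)`. See `integrable_log_measureReal_ball`: on a compact
metric space the integrand is integrable. -/
noncomputable def logBallIntegral {X : Type*} [PseudoMetricSpace X] [MeasurableSpace X]
    (μ : Measure X) (r : ℝ) : ℝ :=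
  ∫ x, Real.log (μ.real (Metric.ball x r)) ∂μ

/-- The upper `L¹`-dimension `limsup_{r → 0+} I_μ(r, 1) / log r`, an extended real number. -/
noncomputable def upperL1Dim {X : Type*} [PseudoMetricSpace X] [MeasurableSpace X]
    (μ : Measure X) : EReal :=
  limsup (fun r : ℝ => ((logBallIntegral μ r / Real.log r : ℝ) : EReal)) (𝓝[>] (0 : ℝ))

/-- On a compact metric space the integral defining `logBallIntegral` converges. -/
theorem integrable_log_measureReal_ball {X : Type*} [MetricSpace X] [CompactSpace X]
    [MeasurableSpace X] [BorelSpace X] (μ : Measure X) [IsProbabilityMeasure μ]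
    (r : ℝ) (hr : 0 < r) :
    Integrable (fun x => Real.log (μ.real (Metric.ball x r))) μ := by
  have hmeas : Measurable (fun x : X => μ.real (Metric.ball x r)) := by
    have hs : MeasurableSet {p : X × X | dist p.2 p.1 < r} :=
      measurableSet_lt (by fun_prop) (by fun_prop)
    exact (measurable_measure_prodMk_left (ν := μ) hs).ennreal_toReal
  obtain ⟨t, -, htfin, ht⟩ := finite_cover_balls_of_compact (isCompact_univ (X := X))
    (half_pos hr)
  have hnull : ∀ᵐ x ∂μ, ∀ c ∈ t, μ (Metric.ball c (r / 2)) = 0 →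
      x ∉ Metric.ball c (r / 2) := by
    rw [ae_ball_iff htfin.countable]
    intro c _
    by_cases h : μ (Metric.ball c (r / 2)) = 0
    · filter_upwards [measure_eq_zero_iff_ae_notMem.1 h] with x hx _ using hx
    · exact Eventually.of_forall fun x h' => absurd h' h
  refine Integrable.of_bound hmeas.log.aestronglyMeasurable
    (∑ c ∈ htfin.toFinset, |Real.log (μ.real (Metric.ball c (r / 2)))|) ?_
  filter_upwards [hnull] with x hx
  obtain ⟨c, hc, hxc⟩ := mem_iUnion₂.1 (ht (mem_univ x))
  have hpos : 0 < μ.real (Metric.ball c (r / 2)) :=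
    ENNReal.toReal_pos (fun h => hx c hc h hxc) (measure_ne_top _ _)
  have hsub : Metric.ball c (r / 2) ⊆ Metric.ball x r := by
    intro y hy
    have h1 := dist_triangle_right y x c
    rw [Metric.mem_ball] at *
    linarith
  have hle : μ.real (Metric.ball c (r / 2)) ≤ μ.real (Metric.ball x r) :=
    measureReal_mono hsub
  have hlog := Real.log_le_log hpos hle
  have h1 : Real.log (μ.real (Metric.ball x r)) ≤ 0 :=
    Real.log_nonpos measureReal_nonneg measureReal_le_one
  calc ‖Real.log (μ.real (Metric.ball x r))‖
      ≤ |Real.log (μ.real (Metric.ball c (r / 2)))| := by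
        rw [Real.norm_eq_abs, abs_of_nonpos h1, abs_of_nonpos (hlog.trans h1)]
        linarith
    _ ≤ _ := Finset.single_le_sum
        (f := fun c => |Real.log (μ.real (Metric.ball c (r / 2)))|)
        (fun _ _ => abs_nonneg _) (htfin.mem_toFinset.2 hc)

/-- The compact set `{0} ∪ [1, 2]` of the real line. -/
def pointInterval : Set ℝ := {0} ∪ Icc 1 2

/-! The upper dimension only sees the mass `m = μ [1, 2]`. For every `μ` it is at most `m`: covering
`[1, 2]` by about `1 / r` cells bounds the entropy by `m * log (1 / r) + O(1)`, while the isolated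
point `0` contributes `O(1)` (`upperL1Dim_le`). For typical `μ` it is also at least `m`: smearing
out the part of a measure on `[1, 2]` gives a dense family with linear ball growth there, and a
Baire argument passes this on, at arbitrarily small scales, to a dense `Gδ` set
(`typical_le_upperL1Dim`). Since `[1, 2]` is clopen, proper and nonempty, `m < ε` and `m > 1 - ε`
both define nonempty open sets of measures. Every dense set meets both, so neither endpoint of `[0,
1]` can be improved. -/

/-- The entropy bound: on a union of `n` disjoint cells of diameter less than `r`, the integral of
`-log μ(B(x, r))` is at most `μ(⋃ cells) * log n + 1`. -/
theorem neg_setIntegral_log_ball_le {X ι : Type*} [PseudoMetricSpace X] [MeasurableSpace X]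
    (μ : Measure X) [IsProbabilityMeasure μ] {r : ℝ}
    (hint : Integrable (fun x => Real.log (μ.real (Metric.ball x r))) μ)
    {t : Finset ι} (ht : t.Nonempty) {A : ι → Set X} (hA : ∀ i ∈ t, MeasurableSet (A i))
    (hdisj : (t : Set ι).Pairwise (Function.onFun Disjoint A))
    (hdiam : ∀ i ∈ t, ∀ x ∈ A i, ∀ y ∈ A i, dist y x < r) :
    -∫ x in ⋃ i ∈ t, A i, Real.log (μ.real (Metric.ball x r)) ∂μ ≤
      μ.real (⋃ i ∈ t, A i) * Real.log t.card + 1 := by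
  have hn : (0 : ℝ) < t.card := by exact_mod_cast ht.card_pos
  have hcell : ∀ i ∈ t, -∫ x in A i, Real.log (μ.real (Metric.ball x r)) ∂μ ≤
      μ.real (A i) * Real.log t.card + 1 / t.card := by
    intro i hi
    rcases eq_or_lt_of_le (measureReal_nonneg (μ := μ) (s := A i)) with h0 | hpos
    · have h0' : μ (A i) = 0 := (measureReal_eq_zero_iff).1 h0.symm
      rw [Measure.restrict_eq_zero.2 h0', integral_zero_measure, ← h0]
      simp
    · have hge : μ.real (A i) * Real.log (μ.real (A i)) ≤
          ∫ x in A i, Real.log (μ.real (Metric.ball x r)) ∂μ := by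
        have := setIntegral_mono_on (μ := μ) (f := fun _ => Real.log (μ.real (A i)))
          integrableOn_const hint.integrableOn (hA i hi) (fun x hx =>
            Real.log_le_log hpos (measureReal_mono fun y hy => hdiam i hi x hx y hy))
        simpa using this
      -- With `p = μ (A i)` and `n` cells, `log u ≤ u - 1` at `u = 1 / (p * n)` gives `-p * log p ≤
      -- p * log n + 1 / n - p`.
      have hlog := Real.log_le_sub_one_of_pos (inv_pos.2 (mul_pos hpos hn))
      rw [Real.log_inv, Real.log_mul hpos.ne' hn.ne'] at hlog
      have h2 := mul_le_mul_of_nonneg_left hlog hpos.le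
      have h3 : μ.real (A i) * ((μ.real (A i) * t.card)⁻¹ - 1) = 1 / t.card - μ.real (A i) := by
        field_simp
      rw [h3] at h2
      linarith
  rw [integral_biUnion_finset t hA hdisj (fun i _ => hint.integrableOn),
    measureReal_biUnion_finset hdisj hA, ← Finset.sum_neg_distrib, Finset.sum_mul]
  refine (Finset.sum_le_sum hcell).trans ?_
  rw [Finset.sum_add_distrib, Finset.sum_const, nsmul_eq_mul, mul_one_div_cancel hn.ne']

/-! ### Geometry of `{0} ∪ [1, 2]` and its cells -/

instance : CompactSpace pointInterval :=
  isCompact_iff_compactSpace.1 (isCompact_singleton.union isCompact_Icc)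

/-- The part `[1, 2]` of `pointInterval`. -/
def intervalPart : Set pointInterval := {x | 1 ≤ (x : ℝ)}

theorem isClosed_intervalPart : IsClosed intervalPart :=
  isClosed_le continuous_const continuous_subtype_val

theorem measurableSet_intervalPart : MeasurableSet intervalPart :=
  isClosed_intervalPart.measurableSet

theorem le_two_of_pointInterval (x : pointInterval) : (x : ℝ) ≤ 2 := by
  rcases x.2 with h | h
  · rw [mem_singleton_iff.1 h]; norm_num
  · exact h.2

theorem eq_zero_of_notMem_intervalPart {x : pointInterval} (hx : x ∉ intervalPart) :
    (x : ℝ) = 0 := by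
  rcases x.2 with h | h
  · exact h
  · exact absurd h.1 hx

theorem isClosed_compl_intervalPart : IsClosed intervalPartᶜ := by
  have : intervalPartᶜ = {x : pointInterval | (x : ℝ) ≤ 0} := by
    ext x
    refine ⟨fun hx => (eq_zero_of_notMem_intervalPart hx).le, fun hx hx' => ?_⟩
    have h1 : (1 : ℝ) ≤ x := hx'
    have h2 : (x : ℝ) ≤ 0 := hx
    linarith
  rw [this]
  exact isClosed_le continuous_subtype_val continuous_const

/-- The points of `[1, 2]` in the `i`-th interval of length `1 / N`. -/
def intervalCell (N i : ℕ) : Set pointInterval :=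
  {x | 1 ≤ (x : ℝ) ∧ ⌊N * ((x : ℝ) - 1)⌋₊ = i}

theorem measurableSet_intervalCell (N i : ℕ) : MeasurableSet (intervalCell N i) := by
  refine measurableSet_intervalPart.inter ?_
  have : Measurable fun x : pointInterval => ⌊(N : ℝ) * ((x : ℝ) - 1)⌋₊ :=
    Nat.measurable_floor.comp (by fun_prop)
  exact this (measurableSet_singleton i)

theorem iUnion_intervalCell (N : ℕ) :
    ⋃ i ∈ Finset.range (N + 1), intervalCell N i = intervalPart := by
  ext x
  simp only [mem_iUnion, Finset.mem_range]
  refine ⟨fun ⟨_, _, hx⟩ => hx.1, fun hx => ⟨_, ?_, hx, rfl⟩⟩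
  refine Nat.lt_succ_of_le (Nat.floor_le_of_le ?_)
  have := le_two_of_pointInterval x
  have : (N : ℝ) * ((x : ℝ) - 1) ≤ N * 1 := by gcongr; linarith
  linarith

theorem dist_lt_of_mem_intervalCell {N i : ℕ} {r : ℝ} (hr : 0 < r) (hN : 1 ≤ N * r)
    {x y : pointInterval} (hx : x ∈ intervalCell N i) (hy : y ∈ intervalCell N i) :
    dist y x < r := by
  have hN0 : (0 : ℝ) < N := by
    by_contra h
    have : (N : ℝ) * r ≤ 0 := mul_nonpos_of_nonpos_of_nonneg (not_lt.1 h) hr.le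
    linarith
  have key : ∀ z ∈ intervalCell N i, (i : ℝ) ≤ N * ((z : ℝ) - 1) ∧ N * ((z : ℝ) - 1) < i + 1 := by
    intro z hz
    rw [← hz.2]
    exact ⟨Nat.floor_le (mul_nonneg hN0.le (sub_nonneg.2 hz.1)), Nat.lt_floor_add_one _⟩
  obtain ⟨hx1, hx2⟩ := key x hx
  obtain ⟨hy1, hy2⟩ := key y hy
  rw [Subtype.dist_eq, Real.dist_eq, abs_lt]
  constructor <;> refine lt_of_mul_lt_mul_left ?_ hN0.le <;> linarith

/-! ### Upper bound by the mass of `[1, 2]` -/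

theorem logBallIntegral_nonpos {X : Type*} [PseudoMetricSpace X] [MeasurableSpace X]
    (μ : Measure X) [IsProbabilityMeasure μ] (r : ℝ) : logBallIntegral μ r ≤ 0 :=
  integral_nonpos fun _ => Real.log_nonpos measureReal_nonneg measureReal_le_one

theorem neg_logBallIntegral_le (μ : Measure pointInterval) [IsProbabilityMeasure μ] {N : ℕ} {r : ℝ}
    (hr : 0 < r) (hN : 1 ≤ N * r) :
    -logBallIntegral μ r ≤ μ.real intervalPart * Real.log (N + 1) + 2 := by
  have hint := integrable_log_measureReal_ball μ r hr
  have h1 := neg_setIntegral_log_ball_le μ hint (t := Finset.range (N + 1)) (by simp)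
    (A := intervalCell N) (fun i _ => measurableSet_intervalCell N i)
    (fun i _ j _ hij => disjoint_left.2 fun x hx hx' => hij (hx.2.symm.trans hx'.2))
    (fun i _ x hx y hy => dist_lt_of_mem_intervalCell hr hN hx hy)
  -- The point `0` is a single cell, so its logarithmic term is `log 1 = 0`.
  have h2 := neg_setIntegral_log_ball_le μ hint (t := ({()} : Finset Unit)) (by simp)
    (A := fun _ => intervalPartᶜ) (fun i _ => measurableSet_intervalPart.compl)
    (fun i _ j _ hij => absurd rfl hij)
    (fun i _ x hx y hy => by
      rw [Subtype.dist_eq, eq_zero_of_notMem_intervalPart hx, eq_zero_of_notMem_intervalPart hy]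
      simpa using hr)
  rw [iUnion_intervalCell] at h1
  simp only [Finset.mem_singleton, iUnion_const, Finset.card_singleton, Nat.cast_one,
    Real.log_one, mul_zero, zero_add, Finset.card_range, Nat.cast_add] at h1 h2
  have h3 := integral_add_compl measurableSet_intervalPart hint
  rw [logBallIntegral, ← h3]
  linarith

theorem logBallIntegral_div_log_le (μ : Measure pointInterval) [IsProbabilityMeasure μ] {r : ℝ}
    (hr : 0 < r) (hr1 : r < 1) :
    logBallIntegral μ r / Real.log r ≤
      μ.real intervalPart - (Real.log 3 + 2) / Real.log r := by
  have hlog : Real.log r < 0 := Real.log_neg hr hr1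
  -- With `N = ⌈1 / r⌉` and `r < 1`, `N + 1 ≤ 3 / r`; this is the source of `log 3`.
  have h1 := neg_logBallIntegral_le μ hr (N := ⌈1 / r⌉₊)
    ((div_le_iff₀ hr).1 (Nat.le_ceil (1 / r)))
  have hN : (⌈1 / r⌉₊ : ℝ) + 1 ≤ 3 / r := by
    have h2 := Nat.ceil_lt_add_one (one_div_pos.2 hr).le
    have h3 : 1 ≤ 1 / r := by rw [le_div_iff₀ hr]; linarith
    have h4 : 3 / r = 1 / r + 1 / r + 1 / r := by ring
    linarith
  have h5 : Real.log (⌈1 / r⌉₊ + 1) ≤ Real.log 3 - Real.log r := by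
    rw [← Real.log_div (by norm_num) hr.ne']
    exact Real.log_le_log (by positivity) hN
  have h6 := mul_le_mul_of_nonneg_left h5 (measureReal_nonneg (μ := μ) (s := intervalPart))
  have h7 : μ.real intervalPart * Real.log 3 ≤ Real.log 3 :=
    mul_le_of_le_one_left (Real.log_nonneg (by norm_num)) measureReal_le_one
  rw [div_le_iff_of_neg hlog, sub_mul, div_mul_cancel₀ _ hlog.ne]
  linarith

theorem upperL1Dim_nonneg {X : Type*} [PseudoMetricSpace X] [MeasurableSpace X]
    (μ : Measure X) [IsProbabilityMeasure μ] : 0 ≤ upperL1Dim μ := by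
  refine le_limsup_of_frequently_le (Eventually.frequently ?_)
  filter_upwards [Ioo_mem_nhdsGT (zero_lt_one' ℝ)] with r hr
  exact EReal.coe_nonneg.2
    (div_nonneg_of_nonpos (logBallIntegral_nonpos μ r) (Real.log_nonpos hr.1.le hr.2.le))

theorem upperL1Dim_le (μ : Measure pointInterval) [IsProbabilityMeasure μ] :
    upperL1Dim μ ≤ (μ.real intervalPart : EReal) := by
  have hlim : Tendsto (fun r : ℝ => μ.real intervalPart - (Real.log 3 + 2) / Real.log r)
      (𝓝[>] 0) (𝓝 (μ.real intervalPart)) := by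
    simpa using tendsto_const_nhds.sub
      (Real.tendsto_log_nhdsGT_zero.const_div_atBot (Real.log 3 + 2))
  rw [← ((continuous_coe_real_ereal.tendsto _).comp hlim).limsup_eq]
  refine limsup_le_limsup ?_
  filter_upwards [Ioo_mem_nhdsGT (zero_lt_one' ℝ)] with r hr
  exact EReal.coe_le_coe_iff.2 (logBallIntegral_div_log_le μ hr.1 hr.2)

/-! ### Lower bound for typical measures -/

/-- One good radius for each `k` suffices, because a limsup is bounded below along any sequence of
radii tending to `0`. -/
theorem le_upperL1Dim (μ : Measure pointInterval) [IsProbabilityMeasure μ]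
    (h : ∀ k : ℕ, ∃ r : ℝ, 0 < r ∧ r < 1 / ((k : ℝ) + 1) ∧ ∀ x ∈ intervalPart,
      μ.real (Metric.ball x r) ≤ r ^ (1 - 1 / ((k : ℝ) + 1))) :
    (μ.real intervalPart : EReal) ≤ upperL1Dim μ := by
  choose r hr0 hr1 hr using h
  have hlim0 : Tendsto r atTop (𝓝[>] 0) :=
    tendsto_nhdsWithin_iff.2 ⟨squeeze_zero (fun k => (hr0 k).le) (fun k => (hr1 k).le)
      tendsto_one_div_add_atTop_nhds_zero_nat, Eventually.of_forall hr0⟩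
  have hlim : Tendsto (fun k : ℕ => μ.real intervalPart * (1 - 1 / ((k : ℝ) + 1))) atTop
      (𝓝 (μ.real intervalPart)) := by
    simpa using (tendsto_one_div_add_atTop_nhds_zero_nat.const_sub (1 : ℝ)).const_mul
      (μ.real intervalPart)
  have hle : ∀ k : ℕ, μ.real intervalPart * (1 - 1 / ((k : ℝ) + 1)) ≤
      logBallIntegral μ (r k) / Real.log (r k) := by
    intro k
    have hr1' : r k < 1 := (hr1 k).trans_le (by
      rw [div_le_one (by positivity)]; linarith [k.cast_nonneg (α := ℝ)])
    have hint := integrable_log_measureReal_ball μ (r k) (hr0 k)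
    have h1 : ∫ x in intervalPart, Real.log (μ.real (Metric.ball x (r k))) ∂μ ≤
        ∫ x in intervalPart, (1 - 1 / ((k : ℝ) + 1)) * Real.log (r k) ∂μ := by
      refine setIntegral_mono_on_ae hint.integrableOn integrableOn_const
        measurableSet_intervalPart ?_
      -- Restricting to the support keeps the balls non-null; otherwise the convention `log 0 = 0`
      -- would break monotonicity.
      filter_upwards [Measure.support_mem_ae (μ := μ)] with x hx hxJ
      have hpos : 0 < μ.real (Metric.ball x (r k)) :=
        ENNReal.toReal_pos ((Measure.mem_support_iff_forall x).1 hx _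
          (Metric.ball_mem_nhds x (hr0 k))).ne' (measure_ne_top _ _)
      rw [← Real.log_rpow (hr0 k)]
      exact Real.log_le_log hpos (hr k x hxJ)
    have h2 : ∫ x in intervalPartᶜ, Real.log (μ.real (Metric.ball x (r k))) ∂μ ≤ 0 :=
      integral_nonpos fun _ => Real.log_nonpos measureReal_nonneg measureReal_le_one
    have h3 := integral_add_compl measurableSet_intervalPart hint
    rw [le_div_iff_of_neg (Real.log_neg (hr0 k) hr1'), logBallIntegral, ← h3]
    rw [setIntegral_const, smul_eq_mul] at h1
    linarith
  rw [← ((continuous_coe_real_ereal.tendsto _).comp hlim).limsup_eq]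
  calc limsup (Real.toEReal ∘ fun k : ℕ => μ.real intervalPart * (1 - 1 / ((k : ℝ) + 1))) atTop
      ≤ limsup (fun k => ((logBallIntegral μ (r k) / Real.log (r k) : ℝ) : EReal)) atTop :=
        limsup_le_limsup (Eventually.of_forall fun k => EReal.coe_le_coe_iff.2 (hle k))
    _ = limsup (fun r : ℝ => ((logBallIntegral μ r / Real.log r : ℝ) : EReal)) (map r atTop) := rfl
    _ ≤ upperL1Dim μ := limsup_le_limsup_of_le hlim0

/-- Portmanteau: the mass of a closed set is upper semicontinuous. -/
theorem isOpen_setOf_measureReal_lt {X : Type*} [TopologicalSpace X] [MeasurableSpace X]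
    [OpensMeasurableSpace X] [HasOuterApproxClosed X] {F : Set X} (hF : IsClosed F) (c : ℝ) :
    IsOpen {μ : ProbabilityMeasure X | (μ : Measure X).real F < c} := by
  rw [isOpen_iff_mem_nhds]
  intro μ hμ
  have h1 := ProbabilityMeasure.limsup_measure_closed_le_of_tendsto
    (tendsto_id (x := 𝓝 μ)) hF
  have h2 : (μ : Measure X) F < ENNReal.ofReal c :=
    (ENNReal.lt_ofReal_iff_toReal_lt (measure_ne_top _ _)).2 hμ
  filter_upwards [eventually_lt_of_limsup_lt (h1.trans_lt h2)] with ν hν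
  exact (ENNReal.lt_ofReal_iff_toReal_lt (measure_ne_top _ _)).1 hν

/-- On `[1, 2]` the convex combination `(1 - δ) x + δ (1 + u)`; the point `0` is fixed. -/
noncomputable def smoothingMap (δ : unitInterval) (p : pointInterval × unitInterval) :
    pointInterval :=
  open Classical in
  if h : 1 ≤ (p.1 : ℝ) then
    ⟨(1 - δ) * p.1 + δ * (1 + p.2), Or.inr (by
      have h1 := le_two_of_pointInterval p.1
      have h2 := p.2.2.1
      have h3 := p.2.2.2
      have h4 := δ.2.1
      have h5 := δ.2.2
      constructor <;> nlinarith)⟩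
  else p.1

theorem coe_smoothingMap (δ : unitInterval) (p : pointInterval × unitInterval) :
    (smoothingMap δ p : ℝ) =
      p.1 + (δ : ℝ) * intervalPart.indicator (fun x => 1 + (p.2 : ℝ) - x) p.1 := by
  rw [smoothingMap]
  split_ifs with h
  · rw [indicator_of_mem (show p.1 ∈ intervalPart from h)]
    ring
  · rw [indicator_of_notMem (show p.1 ∉ intervalPart from h)]
    ring

theorem measurable_smoothingMap (δ : unitInterval) : Measurable (smoothingMap δ) := by
  have h : Measurable fun p : pointInterval × unitInterval =>
      (p.1 : ℝ) + (δ : ℝ) * intervalPart.indicator (fun x => 1 + (p.2 : ℝ) - x) p.1 := by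
    refine Measurable.add (by fun_prop) (Measurable.const_mul ?_ _)
    exact Measurable.indicator (f := fun p : pointInterval × unitInterval => 1 + (p.2 : ℝ) - p.1)
      (by fun_prop) (measurable_fst measurableSet_intervalPart)
  have h2 : Measurable fun p => (smoothingMap δ p : ℝ) := by
    simpa only [coe_smoothingMap] using h
  exact measurable_comap_iff.2 h2

/-- The law of `smoothingMap δ` under `μ` times the uniform measure. -/
noncomputable def smoothing (δ : unitInterval) (μ : ProbabilityMeasure pointInterval) :
    ProbabilityMeasure pointInterval :=
  ⟨((μ : Measure pointInterval).prod volume).map (smoothingMap δ),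
    Measure.isProbabilityMeasure_map (measurable_smoothingMap δ).aemeasurable⟩

/-- `smoothingMap δ p` tends to `p.1` pointwise, so dominated convergence applies to each test
function. -/
theorem tendsto_smoothing (μ : ProbabilityMeasure pointInterval) :
    Tendsto (fun δ => smoothing δ μ) (𝓝[>] 0) (𝓝 μ) := by
  rw [ProbabilityMeasure.tendsto_iff_forall_integral_tendsto]
  intro g
  have h0 : ∫ x, g x ∂(μ : Measure pointInterval) =
      ∫ p, g p.1 ∂((μ : Measure pointInterval).prod (volume : Measure unitInterval)) := by
    rw [integral_fun_fst (fun x => g x)]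
    simp
  have h1 : ∀ δ, ∫ x, g x ∂(smoothing δ μ : Measure pointInterval) =
      ∫ p, g (smoothingMap δ p)
        ∂((μ : Measure pointInterval).prod (volume : Measure unitInterval)) := fun δ =>
    integral_map (measurable_smoothingMap δ).aemeasurable
      g.continuous.measurable.aestronglyMeasurable
  rw [h0]
  simp only [h1]
  refine tendsto_integral_filter_of_dominated_convergence (fun _ => ‖g‖)
    (Eventually.of_forall fun δ =>
      (g.continuous.measurable.comp (measurable_smoothingMap δ)).aestronglyMeasurable)
    (Eventually.of_forall fun δ => Eventually.of_forall fun p => g.norm_coe_le_norm _)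
    (integrable_const _) (Eventually.of_forall fun p => ?_)
  refine (g.continuous.tendsto p.1).comp (tendsto_subtype_rng.2 ?_)
  simp only [coe_smoothingMap]
  have : Continuous fun δ : unitInterval =>
      (p.1 : ℝ) + (δ : ℝ) * intervalPart.indicator (fun x => 1 + (p.2 : ℝ) - x) p.1 := by
    fun_prop
  simpa using (this.tendsto 0).mono_left nhdsWithin_le_nhds

/-- For fixed `x ≥ 1` the map is affine in `u` with slope `δ`, so the ball pulls back into an
interval of length `2 * r / δ`. The point `0` stays at distance at least `1 ≥ r` from `y`. -/
theorem smoothing_ball_le {δ : unitInterval} (hδ : 0 < δ) (μ : ProbabilityMeasure pointInterval)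
    {y : pointInterval} (hy : y ∈ intervalPart) {r : ℝ} (hr : 0 < r) (hr1 : r ≤ 1) :
    (smoothing δ μ : Measure pointInterval).real (Metric.ball y r) ≤ 2 / δ * r := by
  have hδ' : (0 : ℝ) < δ := hδ
  refine ENNReal.toReal_le_of_le_ofReal (by positivity) ?_
  change ((μ : Measure pointInterval).prod volume).map (smoothingMap δ) (Metric.ball y r) ≤ _
  rw [Measure.map_apply (measurable_smoothingMap δ) Metric.isOpen_ball.measurableSet,
    Measure.prod_apply (measurable_smoothingMap δ Metric.isOpen_ball.measurableSet)]
  have key : ∀ x : pointInterval,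
      (volume : Measure unitInterval) (Prod.mk x ⁻¹' (smoothingMap δ ⁻¹' Metric.ball y r)) ≤
        ENNReal.ofReal (2 / δ * r) := by
    intro x
    have hsub : Prod.mk x ⁻¹' (smoothingMap δ ⁻¹' Metric.ball y r) ⊆
        (Subtype.val ⁻¹' Metric.ball ((y - x) / δ + x - 1 : ℝ) (r / δ) : Set unitInterval) := by
      intro u hu
      rw [mem_preimage, mem_preimage, Metric.mem_ball, Subtype.dist_eq, coe_smoothingMap,
        Real.dist_eq] at hu
      by_cases hx : x ∈ intervalPart
      · rw [indicator_of_mem hx] at hu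
        rw [mem_preimage, Metric.mem_ball, Real.dist_eq, lt_div_iff₀ hδ']
        rw [← abs_of_pos hδ', ← abs_mul, abs_of_pos hδ']
        have heq : ((u : ℝ) - ((y - x) / δ + x - 1)) * δ = x + δ * (1 + u - x) - y := by
          field_simp
          ring
        rwa [heq]
      · rw [indicator_of_notMem hx] at hu
        have h1 : (1 : ℝ) ≤ y := hy
        have h2 := (abs_lt.1 hu).1
        simp only [eq_zero_of_notMem_intervalPart hx] at h2
        linarith
    refine (measure_mono hsub).trans ?_
    rw [volume_preimage_coe measurableSet_Icc.nullMeasurableSet Metric.isOpen_ball.measurableSet]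
    refine (measure_mono inter_subset_left).trans_eq ?_
    rw [Real.volume_ball]
    congr 1
    ring
  exact (lintegral_mono key).trans_eq (by simp)

/-- The measures on `pointInterval` whose balls of some radius `r < 1 / (k + 1)` centred in
`[1, 2]` have measure at most `r ^ (1 - 1 / (k + 1))`. -/
def smallBallSet (k : ℕ) : Set (ProbabilityMeasure pointInterval) :=
  {μ | ∃ r : ℝ, 0 < r ∧ r < 1 / ((k : ℝ) + 1) ∧ ∀ x ∈ intervalPart,
    (μ : Measure pointInterval).real (Metric.ball x r) ≤ r ^ (1 - 1 / ((k : ℝ) + 1))}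

theorem mem_interior_smallBallSet {ν : ProbabilityMeasure pointInterval} {M : ℝ}
    (hν : ∀ y ∈ intervalPart, ∀ r : ℝ, 0 < r → r ≤ 1 →
      (ν : Measure pointInterval).real (Metric.ball y r) ≤ M * r) (k : ℕ) :
    ν ∈ interior (smallBallSet k) := by
  set s : ℝ := 1 / ((k : ℝ) + 1) with hs
  have hs0 : 0 < s := by positivity
  -- The gain `r ^ s` absorbs the constant `M * 3`; `r < 1 / 3` lets the hypothesis apply at radius
  -- `3 * r`.
  obtain ⟨r, hrlt, hr0, hrs, hr3⟩ : ∃ r : ℝ, M * 3 * r ^ s < 1 ∧ 0 < r ∧ r < s ∧ r < 1 / 3 := by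
    have h1 : Tendsto (fun r : ℝ => M * 3 * r ^ s) (𝓝[>] 0) (𝓝 0) := by
      have := ((Real.continuousAt_rpow_const 0 s (Or.inr hs0.le)).tendsto.const_mul
        (M * 3)).mono_left (nhdsWithin_le_nhds (s := Ioi 0))
      simpa [Real.zero_rpow hs0.ne'] using this
    obtain ⟨r, hr⟩ := ((h1.eventually_lt_const zero_lt_one).and
      (Ioo_mem_nhdsGT (lt_min hs0 (by norm_num : (0 : ℝ) < 1 / 3)))).exists
    exact ⟨r, hr.1, hr.2.1, hr.2.2.trans_le (min_le_left _ _),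
      hr.2.2.trans_le (min_le_right _ _)⟩
  obtain ⟨t, htJ, htfin, ht⟩ :=
    isClosed_intervalPart.isCompact.finite_cover_balls hr0
  -- Finitely many strict bounds on closed balls form an open condition. Radius `2 * r` covers every
  -- ball of radius `r` centred in `[1, 2]`.
  have hopen : IsOpen (⋂ c ∈ t, {μ : ProbabilityMeasure pointInterval |
      (μ : Measure pointInterval).real (Metric.closedBall c (2 * r)) < r ^ (1 - s)}) :=
    htfin.isOpen_biInter fun c _ => isOpen_setOf_measureReal_lt Metric.isClosed_closedBall _
  refine mem_interior.2 ⟨_, ?_, hopen, mem_iInter₂.2 fun c hc => ?_⟩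
  · intro μ hμ
    refine ⟨r, hr0, hrs, fun x hx => ?_⟩
    obtain ⟨c, hc, hxc⟩ := mem_iUnion₂.1 (ht hx)
    refine (measureReal_mono ?_).trans (mem_iInter₂.1 hμ c hc).le
    refine Metric.ball_subset_closedBall.trans (Metric.closedBall_subset_closedBall' ?_)
    linarith [Metric.mem_ball.1 hxc]
  · calc (ν : Measure pointInterval).real (Metric.closedBall c (2 * r))
        ≤ (ν : Measure pointInterval).real (Metric.ball c (3 * r)) :=
          measureReal_mono (Metric.closedBall_subset_ball (by linarith))
      _ ≤ M * (3 * r) := hν c (htJ hc) _ (by linarith) (by linarith)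
      _ = M * 3 * r ^ s * r ^ (1 - s) := by
          rw [mul_assoc (M * 3), ← Real.rpow_add hr0, add_sub_cancel, Real.rpow_one, mul_assoc]
      _ < r ^ (1 - s) := mul_lt_of_lt_one_left (Real.rpow_pos_of_pos hr0 _) hrlt

theorem dense_interior_smallBallSet (k : ℕ) : Dense (interior (smallBallSet k)) := by
  intro μ
  have : (𝓝[>] (0 : unitInterval)).NeBot := nhdsGT_neBot_of_exists_gt ⟨1, zero_lt_one⟩
  refine mem_closure_of_tendsto (tendsto_smoothing μ) ?_
  filter_upwards [self_mem_nhdsWithin] with δ (hδ : 0 < δ)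
  exact mem_interior_smallBallSet (fun y hy r hr hr1 => smoothing_ball_le hδ μ hy hr hr1) k

theorem typical_le_upperL1Dim : Typical (fun μ : ProbabilityMeasure pointInterval =>
    ((μ : Measure pointInterval).real intervalPart : EReal) ≤
      upperL1Dim (μ : Measure pointInterval)) :=
  ⟨⋂ k, interior (smallBallSet k), IsGδ.iInter_of_isOpen fun _ => isOpen_interior,
    dense_iInter_of_isOpen (fun _ => isOpen_interior) dense_interior_smallBallSet,
    fun μ hμ => le_upperL1Dim μ fun k =>
      interior_subset (s := smallBallSet k) (mem_iInter.1 hμ k)⟩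

/-! ### Sharpness of the interval -/

theorem Typical.and {X : Type*} [TopologicalSpace X] [BaireSpace X] {p q : X → Prop}
    (hp : Typical p) (hq : Typical q) : Typical fun x => p x ∧ q x := by
  obtain ⟨S, hS, hSd, hSp⟩ := hp
  obtain ⟨T, hT, hTd, hTq⟩ := hq
  exact ⟨S ∩ T, hS.inter hT, hSd.inter_of_Gδ hS hT hTd, fun x hx => ⟨hSp x hx.1, hTq x hx.2⟩⟩

theorem Typical.exists_mem {X : Type*} [TopologicalSpace X] {p : X → Prop} (hp : Typical p)
    {U : Set X} (hU : IsOpen U) (hne : U.Nonempty) : ∃ x ∈ U, p x := by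
  obtain ⟨S, -, hSd, hSp⟩ := hp
  obtain ⟨x, hxU, hxS⟩ := hSd.inter_open_nonempty U hU hne
  exact ⟨x, hxU, hSp x hxS⟩

theorem exists_measureReal_lt_of_typical {p : ProbabilityMeasure pointInterval → Prop}
    (hp : Typical p) {F : Set pointInterval} (hF : IsClosed F) (hne : F ≠ univ)
    {ε : ℝ} (hε : 0 < ε) :
    ∃ μ : ProbabilityMeasure pointInterval, (μ : Measure pointInterval).real F < ε ∧ p μ := by
  obtain ⟨x, hx⟩ := (ne_univ_iff_exists_notMem F).1 hne
  -- A Dirac mass outside `F` shows that the open set is nonempty.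
  refine hp.exists_mem (isOpen_setOf_measureReal_lt hF ε) ⟨⟨Measure.dirac x, inferInstance⟩, ?_⟩
  change (Measure.dirac x).real F < ε
  simpa [measureReal_def, Measure.dirac_apply' _ hF.measurableSet, hx] using hε

theorem le_zero_and_one_le_of_typical {a b : EReal}
    (h : Typical (fun μ : ProbabilityMeasure pointInterval =>
      upperL1Dim (μ : Measure pointInterval) ∈ Icc a b)) : a ≤ 0 ∧ 1 ≤ b := by
  constructor
  · refine EReal.le_of_forall_lt_iff_le.1 fun ε hε => ?_
    obtain ⟨μ, hμ, hp⟩ := exists_measureReal_lt_of_typical h isClosed_intervalPart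
      ((ne_univ_iff_exists_notMem _).2 ⟨⟨0, Or.inl rfl⟩, fun h0 => by
        have h1 : (1 : ℝ) ≤ 0 := h0
        norm_num at h1⟩)
      (EReal.coe_pos.1 hε)
    exact (hp.1.trans (upperL1Dim_le _)).trans (EReal.coe_le_coe_iff.2 hμ.le)
  · refine EReal.ge_of_forall_gt_iff_ge.1 fun c hc => ?_
    have hc1 : c < 1 := by exact_mod_cast hc
    -- Here the dimension must be large, so the typical lower bound is intersected in; the
    -- complement of `[1, 2]` gets mass below `1 - c`.
    obtain ⟨μ, hμ, hp, hq⟩ := exists_measureReal_lt_of_typical (h.and typical_le_upperL1Dim)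
      isClosed_compl_intervalPart
      ((ne_univ_iff_exists_notMem _).2 ⟨⟨1, Or.inr (by norm_num)⟩, fun h1 => h1 (le_refl (1 : ℝ))⟩)
      (sub_pos.2 hc1)
    rw [probReal_compl_eq_one_sub measurableSet_intervalPart] at hμ
    exact ((EReal.coe_le_coe_iff.2 (by linarith)).trans hq).trans hp.2

theorem mainTheorem7 :
    Typical (fun μ : ProbabilityMeasure pointInterval =>
      upperL1Dim (μ : Measure pointInterval) ∈ Icc (0 : EReal) 1) ∧
    (∀ a b : EReal,
      Typical (fun μ : ProbabilityMeasure pointInterval =>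
        upperL1Dim (μ : Measure pointInterval) ∈ Icc a b) → a ≤ 0 ∧ 1 ≤ b) ∧
    ¬ ∃ s : EReal, Typical (fun μ : ProbabilityMeasure pointInterval =>
      upperL1Dim (μ : Measure pointInterval) = s) := by
  refine ⟨⟨univ, IsGδ.univ, dense_univ, fun μ _ => ⟨upperL1Dim_nonneg _,
    (upperL1Dim_le _).trans (by exact_mod_cast measureReal_le_one)⟩⟩,
    fun a b h => le_zero_and_one_le_of_typical h, ?_⟩
  rintro ⟨s, S, hS, hSd, hSp⟩
  have h := le_zero_and_one_le_of_typical (a := s) (b := s)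
    ⟨S, hS, hSd, fun μ hμ => ⟨(hSp μ hμ).ge, (hSp μ hμ).le⟩⟩
  exact absurd (h.2.trans h.1) (by norm_num)
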